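/- Let $\mathbb M_{n_1,n_2}$ be the space of real or complex $n_1\times n_2$ matrices with the Frobenius norm $\|\cdot\|_F$, let $\mathcal A$ be a real-linear map from $\mathbb M_{n_1,n_2}$ to $\mathbb R^m$ or $\mathbb C^m$ (with the Euclidean norm $\|\cdot\|_2$), and let $\mu\ge 0$. Write $\sigma_1(X)\ge\sigma_2(X)\ge\dots\ge\sigma_{\min(n_1,n_2)}(X)\ge 0$ for the singular values of $X$, put $r_\mu(s)=\mu-\max(\sqrt\mu-s,0)^2$, and define $\delta_k^-$ by $$1-\delta_k^-=\inf\left\{\frac{\|\mathcal A X\|_2^2}{\|X\|_F^2}:\ X\ne 0,\ \operatorname{rank}(X)\le k\right\}.$$ Call $X$ a stationary point of a functional $g$ on $\mathbb M_{n_1,n_2}$ if $$\liminf_{Y\to X,\ Y\ne X}\frac{g(Y)-g(X)}{\|Y-X\|_F}\ge 0 .$$ Suppose that $b=\mathcal A X_0$ where $\operatorname{rank}(X_0)=K\ge 1$, that $0<\delta_{2K}^-<1$, and that $$\sigma_K(X_0)>\frac{\sqrt\mu}{1-\delta_{2K}^-}.$$ Then $X_0$ is a stationary point of $$\mathcal R(X)=\sum_{i=1}^{\min(n_1,n_2)}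 r_\mu(\sigma_i(X))+\|\mathcal A X-b\|_2^2 ,$$ it is the unique minimizer of $\mathcal R$ among matrices of rank at most $K$, i.e. $$\operatorname*{arg\,min}_{\operatorname{rank}(X)\le K}\mathcal R(X)=\{X_0\},$$ and every stationary point $X\ne X_0$ of $\mathcal R$ satisfies $\operatorname{rank}(X)>K$. -/

import Mathlib

open Filter Topology

noncomputable section

namespace LowRank

-- Matrices are normed by the Frobenius norm.
attribute [local instance] Matrix.frobeniusNormedAddCommGroup

/-- `X` is a stationary point of `g` if `liminf_{Y → X, Y ≠ X} (g Y - g X) / ‖Y - X‖ ≥ 0`,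
the lower limit being taken in the extended reals. -/
def IsStationaryPoint {E : Type*} [NormedAddCommGroup E] (g : E → ℝ) (X : E) : Prop :=
  (0 : EReal) ≤ liminf (fun Y => (((g Y - g X) / ‖Y - X‖ : ℝ) : EReal)) (𝓝[≠] X)

variable {𝕜 : Type*} [RCLike 𝕜] {n₁ n₂ : ℕ}

/-- Singular values of a matrix in non-increasing order, counted from zero: `singularValue X i` is
the number usually written `σ_{i+1}(X)`. -/
def singularValue (X : Matrix (Fin n₁) (Fin n₂) 𝕜) (i : ℕ) : ℝ :=
  (Matrix.toEuclideanLin X).singularValues i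

/-- `r_μ(s) = μ - max(√μ - s, 0)²`. -/
def rPenalty (μ s : ℝ) : ℝ := μ - max (√μ - s) 0 ^ 2

variable {𝕂 : Type*} [RCLike 𝕂] {m : ℕ}

/-- The lower restricted isometry constant `δ_k⁻` of `A`, determined by
`1 - δ_k⁻ = inf {‖A X‖² / ‖X‖_F² : X ≠ 0, rank X ≤ k}`. -/
def lripConst (A : Matrix (Fin n₁) (Fin n₂) 𝕜 →ₗ[ℝ] EuclideanSpace 𝕂 (Fin m)) (k : ℕ) : ℝ :=
  1 - sInf {q : ℝ | ∃ X : Matrix (Fin n₁) (Fin n₂) 𝕜,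
    X ≠ 0 ∧ X.rank ≤ k ∧ q = ‖A X‖ ^ 2 / ‖X‖ ^ 2}

/-- The functional `X ↦ ∑ᵢ r_μ(σᵢ(X)) + ‖A X - b‖²`, the sum being over all `min n₁ n₂` singular
values. -/
def regFunctional (A : Matrix (Fin n₁) (Fin n₂) 𝕜 →ₗ[ℝ] EuclideanSpace 𝕂 (Fin m))
    (b : EuclideanSpace 𝕂 (Fin m)) (μ : ℝ) (X : Matrix (Fin n₁) (Fin n₂) 𝕜) : ℝ :=
  ∑ i ∈ Finset.range (min n₁ n₂), rPenalty μ (singularValue X i) + ‖A X - b‖ ^ 2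

/-- `X` is a stationary point, with respect to the Frobenius norm, of the functional above. -/
def IsStationaryReg (A : Matrix (Fin n₁) (Fin n₂) 𝕜 →ₗ[ℝ] EuclideanSpace 𝕂 (Fin m))
    (b : EuclideanSpace 𝕂 (Fin m)) (μ : ℝ) (X : Matrix (Fin n₁) (Fin n₂) 𝕜) : Prop :=
  IsStationaryPoint (regFunctional A b μ) X

end LowRank

end

open Filter Topology

noncomputable section

namespace LowRank

/-! ### Scalar inequalities for the penalty. -/

section Scalar

/-! Write `P` for the spectral penalty and fix `c` between `√μ / σ_K(X₀)` and `1 - δ`, where `δ` is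
the lower constant at rank `2K`. Every singular value of `X₀` is then 0 or at least `√μ / c`. This
gap gives two inequalities. The first, `P(X₀) ≤ P(Y) + c‖Y - X₀‖²` for all `Y`
(`penalty_le_add_mul_norm_sq`), makes `X₀` stationary, and since `‖A(Y - X₀)‖² > c‖Y - X₀‖²` for `Y
≠ X₀` of rank at most `K`, it makes `X₀` the strict minimizer there. The second
(`sum_max_mul_re_inner_le`) bounds half the directional slope of `P` at any `X` towards `X₀` by `c‖X
- X₀‖²`; stationarity bounds it below by `‖A(X - X₀)‖²`, so `X ≠ X₀` cannot have rank at most `K`.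

Both inequalities reduce to scalar ones by averaging against a doubly substochastic matrix of
overlaps of singular vectors. No perturbation theory of singular values is needed for the slope: `s
↦ r_μ(√s)` is concave, so `P(T)` is at most the sum of `r_μ(‖T w_k‖)` over any orthonormal basis,
and likewise for the adjoint. `exists_direction_split` turns these bounds into one-sided first-order
estimates. -/

lemma rPenalty_zero {μ : ℝ} (hμ : 0 ≤ μ) : rPenalty μ 0 = 0 := by
  simp [rPenalty, Real.sq_sqrt hμ]

lemma rPenalty_of_le {μ s : ℝ} (hμ : 0 ≤ μ) (hs : s ≤ √μ) :
    rPenalty μ s = 2 * √μ * s - s ^ 2 := by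
  have h := Real.sq_sqrt hμ
  rw [rPenalty, max_eq_left (by linarith)]
  linear_combination -h

lemma rPenalty_of_ge {μ s : ℝ} (hs : √μ ≤ s) : rPenalty μ s = μ := by
  rw [rPenalty, max_eq_right (by linarith)]
  ring

lemma rPenalty_le (μ s : ℝ) : rPenalty μ s ≤ μ := by
  have := sq_nonneg (max (√μ - s) 0)
  rw [rPenalty]
  linarith

lemma rPenalty_nonneg {μ s : ℝ} (hμ : 0 ≤ μ) (hs : 0 ≤ s) : 0 ≤ rPenalty μ s := by
  rcases le_total s √μ with h | h
  · rw [rPenalty_of_le hμ h]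
    nlinarith
  · rwa [rPenalty_of_ge h]

lemma rPenalty_le_linear {μ s : ℝ} (hμ : 0 ≤ μ) (hs : 0 ≤ s) :
    rPenalty μ s ≤ 2 * √μ * s := by
  rcases le_total s √μ with h | h
  · rw [rPenalty_of_le hμ h]
    nlinarith
  · rw [rPenalty_of_ge h]
    nlinarith [Real.sq_sqrt hμ, Real.sqrt_nonneg μ]

/-- `s ↦ r_μ(√s)` is concave: it lies below its tangent at `x²`. -/
lemma rPenalty_le_tangent {μ x : ℝ} (hμ : 0 ≤ μ) (hx : 0 < x) (s : ℝ) :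
    rPenalty μ s ≤ rPenalty μ x + max (√μ - x) 0 / x * (s ^ 2 - x ^ 2) := by
  rcases le_total x √μ with h | h
  · rw [rPenalty_of_le hμ h, max_eq_left (by linarith)]
    have key : ∀ y : ℝ, 2 * √μ * y - y ^ 2 ≤
        2 * √μ * x - x ^ 2 + (√μ - x) / x * (y ^ 2 - x ^ 2) := by
      intro y
      have : 2 * √μ * x - x ^ 2 + (√μ - x) / x * (y ^ 2 - x ^ 2) - (2 * √μ * y - y ^ 2)
          = √μ / x * (y - x) ^ 2 := by
        field_simp
        ring
      have h2 : 0 ≤ √μ / x * (y - x) ^ 2 := by positivity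
      linarith
    rcases le_total s √μ with h' | h'
    · rw [rPenalty_of_le hμ h']
      exact key s
    · rw [rPenalty_of_ge h']
      have h1 := key √μ
      have h2 : (√μ - x) / x * (√μ ^ 2 - x ^ 2) ≤ (√μ - x) / x * (s ^ 2 - x ^ 2) := by
        have : 0 ≤ (√μ - x) / x := div_nonneg (by linarith) hx.le
        gcongr
      nlinarith [Real.sq_sqrt hμ]
  · rw [rPenalty_of_ge h, max_eq_right (by linarith)]
    simpa using rPenalty_le μ s

/-- Jensen's inequality for `s ↦ r_μ(√s)`. Total mass below one is harmless: the missing mass can be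
placed at 0, where the penalty vanishes. -/
lemma sum_mul_rPenalty_le {μ : ℝ} (hμ : 0 ≤ μ) {ι : Type*} [Fintype ι] (p s : ι → ℝ)
    (hp : ∀ i, 0 ≤ p i) (hp1 : ∑ i, p i ≤ 1) {x : ℝ} (hx : 0 ≤ x)
    (hxs : x ^ 2 = ∑ i, p i * s i ^ 2) : ∑ i, p i * rPenalty μ (s i) ≤ rPenalty μ x := by
  rcases hx.eq_or_lt with rfl | hx
  · rw [rPenalty_zero hμ]
    apply Finset.sum_nonpos
    intro i hi
    have h0 : p i * s i ^ 2 = 0 :=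
      (Finset.sum_eq_zero_iff_of_nonneg (fun i _ => mul_nonneg (hp i) (sq_nonneg _))).1
        (by rw [← hxs]; norm_num) i hi
    rcases mul_eq_zero.1 h0 with h | h
    · simp [h]
    · rw [pow_eq_zero_iff two_ne_zero] at h
      simp [h, rPenalty_zero hμ]
  · set k := max (√μ - x) 0 / x
    -- The tangent at `x²` has nonnegative intercept at 0, which absorbs the missing mass.
    have hk : k * x ^ 2 ≤ rPenalty μ x := by
      have : k * x ^ 2 = max (√μ - x) 0 * x := by
        simp only [k]
        field_simp
      rw [this]
      rcases le_total x √μ with h | h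
      · rw [rPenalty_of_le hμ h, max_eq_left (by linarith)]
        nlinarith [Real.sqrt_nonneg μ]
      · rw [rPenalty_of_ge h, max_eq_right (by linarith)]
        simpa
    calc ∑ i, p i * rPenalty μ (s i)
        ≤ ∑ i, p i * (rPenalty μ x + k * (s i ^ 2 - x ^ 2)) := by
          gcongr with i
          · exact hp i
          · exact rPenalty_le_tangent hμ hx (s i)
      _ = (∑ i, p i) * (rPenalty μ x - k * x ^ 2) + k * ∑ i, p i * s i ^ 2 := by
          rw [Finset.sum_mul, Finset.mul_sum, ← Finset.sum_add_distrib]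
          exact Finset.sum_congr rfl fun i _ => by ring
      _ ≤ rPenalty μ x := by
          rw [← hxs]
          nlinarith

lemma rPenalty_le_mul_sq {μ c x : ℝ} (hμ : 0 ≤ μ) (hc : 0 ≤ c) (hc1 : c ≤ 1)
    (hx : x = 0 ∨ √μ ≤ c * x) : rPenalty μ x ≤ c * x ^ 2 := by
  rcases hx with rfl | hx
  · simp [rPenalty_zero hμ]
  · have h1 := Real.sq_sqrt hμ
    have h2 := pow_le_pow_left₀ (Real.sqrt_nonneg μ) hx 2
    have h3 := rPenalty_le μ x
    have h4 : c * (c * x ^ 2) ≤ c * x ^ 2 := mul_le_of_le_one_left (by positivity) hc1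
    linarith

/-- For `y ≤ √μ ≤ c x` the gap `μ - r_μ(y)` is `(√μ - y)²`; one factor is at most `c(x - y)`, the
other at most `x - y`. -/
lemma rPenalty_le_add_mul_sq {μ c x y : ℝ} (hμ : 0 ≤ μ) (hc : 0 ≤ c) (hc1 : c ≤ 1)
    (hy : 0 ≤ y) (hx0 : 0 ≤ x) (hx : x = 0 ∨ √μ ≤ c * x) :
    rPenalty μ x ≤ rPenalty μ y + c * (y - x) ^ 2 := by
  rcases hx with rfl | hx
  · rw [rPenalty_zero hμ]
    have := rPenalty_nonneg hμ hy
    positivity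
  · have h1 := Real.sq_sqrt hμ
    have h2 := Real.sqrt_nonneg μ
    refine (rPenalty_le μ x).trans ?_
    rcases le_total y √μ with h | h
    · rw [rPenalty_of_le hμ h]
      have hcx : √μ ≤ x := by nlinarith
      have hcy : c * y ≤ y := mul_le_of_le_one_left hy hc1
      have := mul_le_mul (show √μ - y ≤ c * (x - y) by linarith)
        (show √μ - y ≤ x - y by linarith) (by linarith) (by nlinarith)
      linarith
    · rw [rPenalty_of_ge h]
      have : 0 ≤ c * (y - x) ^ 2 := by positivity
      linarith

/-- First-order counterpart: `2 max(√μ - y, 0)` is the derivative of `r_μ` at `y`. -/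
lemma max_mul_sub_le {μ c x y : ℝ} (hc : 0 ≤ c) (hc1 : c ≤ 1) (hy : 0 ≤ y) (hx0 : 0 ≤ x)
    (hx : x = 0 ∨ √μ ≤ c * x) : max (√μ - y) 0 * (x - y) ≤ c * (x - y) ^ 2 := by
  have hsq : 0 ≤ c * (x - y) ^ 2 := by positivity
  rcases hx with rfl | hx
  · have : 0 ≤ max (√μ - y) 0 * y := mul_nonneg (le_max_right _ _) hy
    linarith
  · rcases le_total y √μ with h | h
    · rw [max_eq_left (by linarith), pow_two, ← mul_assoc]
      apply mul_le_mul_of_nonneg_right <;> nlinarith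
    · rw [max_eq_right (by linarith), zero_mul]
      exact hsq

end Scalar

/-! ### Averaging against doubly substochastic weights. -/

section Substochastic

variable {ι κ : Type*} [Fintype ι] [Fintype κ]

/-- Lower bound for `‖Y - X‖²` in terms of the singular values of `Y` and `X` and the overlaps `p`
of the singular vectors. -/
lemma sum_mul_sq_sub_le {p : ι → κ → ℝ} {y q : ι → ℝ} {x : κ → ℝ} (hy : ∀ i, 0 ≤ y i)
    (hq : ∀ i, q i ≤ ∑ j, p i j * x j) :
    ∑ i, ∑ j, p i j * (y i - x j) ^ 2 + ∑ i, (1 - ∑ j, p i j) * y i ^ 2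
      + ∑ j, (1 - ∑ i, p i j) * x j ^ 2
      ≤ ∑ i, y i ^ 2 + ∑ j, x j ^ 2 - 2 * ∑ i, y i * q i := by
  have h1 : ∑ i, y i * q i ≤ ∑ i, ∑ j, p i j * (y i * x j) := by
    refine Finset.sum_le_sum fun i _ => ?_
    calc y i * q i ≤ y i * ∑ j, p i j * x j := mul_le_mul_of_nonneg_left (hq i) (hy i)
      _ = _ := by
        rw [Finset.mul_sum]
        exact Finset.sum_congr rfl fun j _ => by ring
  have h2 : ∑ i, (1 - ∑ j, p i j) * y i ^ 2
      = ∑ i, y i ^ 2 - ∑ i, ∑ j, p i j * y i ^ 2 := by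
    simp [sub_mul, Finset.sum_sub_distrib, Finset.sum_mul]
  have h3 : ∑ j, (1 - ∑ i, p i j) * x j ^ 2
      = ∑ j, x j ^ 2 - ∑ i, ∑ j, p i j * x j ^ 2 := by
    rw [Finset.sum_comm (s := Finset.univ (α := ι))]
    simp [sub_mul, Finset.sum_sub_distrib, Finset.sum_mul]
  have h4 : ∑ i, ∑ j, p i j * (y i - x j) ^ 2 = ∑ i, ∑ j, p i j * y i ^ 2
      + ∑ i, ∑ j, p i j * x j ^ 2 - 2 * ∑ i, ∑ j, p i j * (y i * x j) := by
    simp only [Finset.mul_sum, ← Finset.sum_add_distrib, ← Finset.sum_sub_distrib]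
    exact Finset.sum_congr rfl fun i _ => Finset.sum_congr rfl fun j _ => by ring
  linarith

variable {p : ι → κ → ℝ} {y q : ι → ℝ} {x : κ → ℝ} {μ c : ℝ}

/-- The scalar bound is averaged over pairs `(i, j)`. Missing column mass compares `x j` with 0;
missing row mass only helps. -/
lemma sum_rPenalty_le_of_substochastic (hμ : 0 ≤ μ) (hc : 0 ≤ c) (hc1 : c ≤ 1)
    (hp : ∀ i j, 0 ≤ p i j) (hrow : ∀ i, ∑ j, p i j ≤ 1) (hcol : ∀ j, ∑ i, p i j ≤ 1)
    (hy : ∀ i, 0 ≤ y i) (hx : ∀ j, 0 ≤ x j) (hxc : ∀ j, x j = 0 ∨ √μ ≤ c * x j)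
    (hq : ∀ i, q i ≤ ∑ j, p i j * x j) :
    ∑ j, rPenalty μ (x j) ≤ ∑ i, rPenalty μ (y i)
      + c * (∑ i, y i ^ 2 + ∑ j, x j ^ 2 - 2 * ∑ i, y i * q i) := by
  have h0 := mul_le_mul_of_nonneg_left (sum_mul_sq_sub_le hy hq) hc
  have h1 : ∑ i, ∑ j, p i j * rPenalty μ (x j) ≤
      ∑ i, ∑ j, p i j * rPenalty μ (y i) + c * ∑ i, ∑ j, p i j * (y i - x j) ^ 2 := by
    simp only [Finset.mul_sum, ← Finset.sum_add_distrib]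
    refine Finset.sum_le_sum fun i _ => Finset.sum_le_sum fun j _ => ?_
    have := mul_le_mul_of_nonneg_left
      (rPenalty_le_add_mul_sq hμ hc hc1 (hy i) (hx j) (hxc j)) (hp i j)
    linarith
  have h2 : ∑ i, ∑ j, p i j * rPenalty μ (y i) ≤ ∑ i, rPenalty μ (y i) := by
    refine Finset.sum_le_sum fun i _ => ?_
    rw [← Finset.sum_mul]
    exact mul_le_of_le_one_left (rPenalty_nonneg hμ (hy i)) (hrow i)
  have h3 : ∑ j, (1 - ∑ i, p i j) * rPenalty μ (x j)
      ≤ c * ∑ j, (1 - ∑ i, p i j) * x j ^ 2 := by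
    rw [Finset.mul_sum]
    refine Finset.sum_le_sum fun j _ => ?_
    have := mul_le_mul_of_nonneg_left (rPenalty_le_mul_sq hμ hc hc1 (hxc j))
      (sub_nonneg.2 (hcol j))
    linarith
  have h4 : ∑ j, (1 - ∑ i, p i j) * rPenalty μ (x j)
      = ∑ j, rPenalty μ (x j) - ∑ i, ∑ j, p i j * rPenalty μ (x j) := by
    rw [Finset.sum_comm (s := Finset.univ (α := ι))]
    simp [sub_mul, Finset.sum_sub_distrib, Finset.sum_mul]
  have h5 : 0 ≤ c * ∑ i, (1 - ∑ j, p i j) * y i ^ 2 :=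
    mul_nonneg hc (Finset.sum_nonneg fun i _ =>
      mul_nonneg (sub_nonneg.2 (hrow i)) (sq_nonneg _))
  linarith

lemma sum_max_mul_sub_le_of_substochastic (hc : 0 ≤ c) (hc1 : c ≤ 1)
    (hp : ∀ i j, 0 ≤ p i j) (hrow : ∀ i, ∑ j, p i j ≤ 1) (hcol : ∀ j, ∑ i, p i j ≤ 1)
    (hy : ∀ i, 0 ≤ y i) (hx : ∀ j, 0 ≤ x j) (hxc : ∀ j, x j = 0 ∨ √μ ≤ c * x j)
    (hq : ∀ i, q i ≤ ∑ j, p i j * x j) :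
    ∑ i, max (√μ - y i) 0 * (q i - y i)
      ≤ c * (∑ i, y i ^ 2 + ∑ j, x j ^ 2 - 2 * ∑ i, y i * q i) := by
  have h0 := mul_le_mul_of_nonneg_left (sum_mul_sq_sub_le hy hq) hc
  have h1 : ∑ i, max (√μ - y i) 0 * (q i - y i)
      ≤ c * ∑ i, ∑ j, p i j * (y i - x j) ^ 2 := by
    rw [Finset.mul_sum]
    refine Finset.sum_le_sum fun i _ => ?_
    set k := max (√μ - y i) 0 with hk
    have hk0 : 0 ≤ k := le_max_right _ _
    calc k * (q i - y i) ≤ k * (∑ j, p i j * x j - (∑ j, p i j) * y i) := by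
          apply mul_le_mul_of_nonneg_left _ hk0
          have := mul_le_of_le_one_left (hy i) (hrow i)
          linarith [hq i]
      _ = ∑ j, p i j * (k * (x j - y i)) := by
          rw [Finset.sum_mul, ← Finset.sum_sub_distrib, Finset.mul_sum]
          exact Finset.sum_congr rfl fun j _ => by ring
      _ ≤ c * ∑ j, p i j * (y i - x j) ^ 2 := by
          rw [Finset.mul_sum]
          refine Finset.sum_le_sum fun j _ => ?_
          have := mul_le_mul_of_nonneg_left
            (max_mul_sub_le hc hc1 (hy i) (hx j) (hxc j)) (hp i j)
          linarith
  have h2 : 0 ≤ c * ∑ j, (1 - ∑ i, p i j) * x j ^ 2 :=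
    mul_nonneg hc (Finset.sum_nonneg fun j _ =>
      mul_nonneg (sub_nonneg.2 (hcol j)) (sq_nonneg _))
  have h5 : 0 ≤ c * ∑ i, (1 - ∑ j, p i j) * y i ^ 2 :=
    mul_nonneg hc (Finset.sum_nonneg fun i _ =>
      mul_nonneg (sub_nonneg.2 (hrow i)) (sq_nonneg _))
  linarith

end Substochastic

/-! ### Singular value decompositions and the variational bound for the penalty. -/

section SVD

open scoped InnerProductSpace

variable {𝕜 : Type*} [RCLike 𝕜]
  {E : Type*} [NormedAddCommGroup E] [InnerProductSpace 𝕜 E]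
  {F : Type*} [NormedAddCommGroup F] [InnerProductSpace 𝕜 F]
  {ι κ : Type*} [Fintype ι] [Fintype κ]

/-- A singular value decomposition `T v_i = s_i u_i`, where `v` is an orthonormal basis and the
`u_i` are pairwise orthogonal, each of norm one, except that `u_i = 0` is allowed if `s_i = 0`. -/
structure IsSVD (T : E →ₗ[𝕜] F) (v : OrthonormalBasis ι 𝕜 E) (s : ι → ℝ) (u : ι → F) : Prop where
  nonneg : ∀ i, 0 ≤ s i
  apply_eq : ∀ i, T (v i) = (s i : 𝕜) • u i
  orthogonal : ∀ i j, i ≠ j → ⟪u i, u j⟫_𝕜 = 0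
  norm_eq : ∀ i, u i = 0 ∨ ‖u i‖ = 1
  norm_eq_one : ∀ i, s i ≠ 0 → ‖u i‖ = 1

lemma sum_sq_norm_inner_le_of_orthogonal {u : ι → F} (ho : ∀ i j, i ≠ j → ⟪u i, u j⟫_𝕜 = 0)
    (hn : ∀ i, u i = 0 ∨ ‖u i‖ = 1) (a : F) : ∑ i, ‖⟪u i, a⟫_𝕜‖ ^ 2 ≤ ‖a‖ ^ 2 := by
  classical
  -- Bessel's inequality applies once the zero vectors are discarded.
  have hon : Orthonormal 𝕜 (fun i : {i // u i ≠ 0} => u i) :=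
    ⟨fun i => (hn i).resolve_left i.2, fun i j hij => ho i j fun h => hij (Subtype.ext h)⟩
  have h := hon.sum_inner_products_le a (s := Finset.univ)
  refine le_trans (le_of_eq ?_) h
  rw [← Finset.sum_filter_of_ne (p := fun i => u i ≠ 0)]
  · exact Finset.sum_subtype _ (by simp) _
  · rintro i - h0 hu0
    simp [hu0] at h0

lemma norm_sum_sq_of_orthogonal {z : ι → F} (ho : ∀ i j, i ≠ j → ⟪z i, z j⟫_𝕜 = 0) :
    ‖∑ i, z i‖ ^ 2 = ∑ i, ‖z i‖ ^ 2 := by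
  have h : ⟪∑ i, z i, ∑ i, z i⟫_𝕜 = ∑ i, ⟪z i, z i⟫_𝕜 := by
    rw [sum_inner]
    refine Finset.sum_congr rfl fun i _ => ?_
    rw [inner_sum]
    exact Finset.sum_eq_single i (fun j _ hj => ho i j hj.symm) (by simp)
  simp only [inner_self_eq_norm_sq_to_K] at h
  exact_mod_cast h

namespace IsSVD

variable {T : E →ₗ[𝕜] F} {v : OrthonormalBasis ι 𝕜 E} {s : ι → ℝ} {u : ι → F}

lemma of_orthogonal (h : ∀ i j, i ≠ j → ⟪T (v i), T (v j)⟫_𝕜 = 0) :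
    IsSVD T v (fun i => ‖T (v i)‖) (fun i => ((‖T (v i)‖ : 𝕜)⁻¹) • T (v i)) where
  nonneg i := norm_nonneg _
  apply_eq i := by
    by_cases h0 : T (v i) = 0
    · simp [h0]
    · rw [smul_smul, mul_inv_cancel₀ (by simpa using h0), one_smul]
  orthogonal i j hij := by simp [inner_smul_left, inner_smul_right, h i j hij]
  norm_eq i := by
    by_cases h0 : T (v i) = 0
    · simp [h0]
    · right
      simp [norm_smul, h0]
  norm_eq_one i hi := by simp [norm_smul, hi]

lemma norm_apply_basis (h : IsSVD T v s u) (i : ι) : ‖T (v i)‖ = s i := by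
  rw [h.apply_eq, norm_smul, RCLike.norm_ofReal, abs_of_nonneg (h.nonneg i)]
  by_cases h0 : s i = 0
  · simp [h0]
  · simp [h.norm_eq_one i h0]

lemma norm_le_one (h : IsSVD T v s u) (i : ι) : ‖u i‖ ≤ 1 := by
  rcases h.norm_eq i with h | h <;> simp [h]

lemma apply_eq_sum (h : IsSVD T v s u) (w : E) :
    T w = ∑ i, (⟪v i, w⟫_𝕜 * s i) • u i := by
  conv_lhs => rw [← v.sum_repr' w, map_sum]
  exact Finset.sum_congr rfl fun i _ => by rw [map_smul, h.apply_eq, smul_smul]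

lemma norm_sq_apply (h : IsSVD T v s u) (w : E) :
    ‖T w‖ ^ 2 = ∑ i, ‖⟪v i, w⟫_𝕜‖ ^ 2 * s i ^ 2 := by
  rw [h.apply_eq_sum w, norm_sum_sq_of_orthogonal (𝕜 := 𝕜)]
  · refine Finset.sum_congr rfl fun i _ => ?_
    rw [norm_smul, norm_mul, RCLike.norm_ofReal, mul_pow, mul_pow, sq_abs]
    by_cases h0 : s i = 0
    · simp [h0]
    · simp [h.norm_eq_one i h0]
  · intro i j hij
    simp [inner_smul_left, inner_smul_right, h.orthogonal i j hij]

variable {μ : ℝ}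

/-- Jensen with the weights `‖⟪v i, w k⟫‖²`, which are doubly stochastic. -/
lemma sum_rPenalty_le (hμ : 0 ≤ μ) (h : IsSVD T v s u) (w : OrthonormalBasis κ 𝕜 E) :
    ∑ i, rPenalty μ (s i) ≤ ∑ k, rPenalty μ ‖T (w k)‖ := by
  calc ∑ i, rPenalty μ (s i) = ∑ i, ∑ k, ‖⟪v i, w k⟫_𝕜‖ ^ 2 * rPenalty μ (s i) := by
        refine Finset.sum_congr rfl fun i _ => ?_
        rw [← Finset.sum_mul, w.sum_sq_norm_inner_left]
        simp
    _ = ∑ k, ∑ i, ‖⟪v i, w k⟫_𝕜‖ ^ 2 * rPenalty μ (s i) := Finset.sum_comm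
    _ ≤ _ := by
        refine Finset.sum_le_sum fun k _ => ?_
        refine sum_mul_rPenalty_le hμ _ _ (fun i => by positivity) ?_ (norm_nonneg _)
          (h.norm_sq_apply _)
        rw [v.sum_sq_norm_inner_right]
        simp

variable [FiniteDimensional 𝕜 E] [FiniteDimensional 𝕜 F]

lemma norm_sq_adjoint_apply (h : IsSVD T v s u) (w : F) :
    ‖T.adjoint w‖ ^ 2 = ∑ i, ‖⟪u i, w⟫_𝕜‖ ^ 2 * s i ^ 2 := by
  rw [← v.sum_sq_norm_inner_right]
  refine Finset.sum_congr rfl fun i _ => ?_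
  rw [LinearMap.adjoint_inner_right, h.apply_eq, inner_smul_left, norm_mul, mul_pow]
  simp [mul_comm]

lemma sum_rPenalty_le_adjoint (hμ : 0 ≤ μ) (h : IsSVD T v s u) (w : OrthonormalBasis κ 𝕜 F) :
    ∑ i, rPenalty μ (s i) ≤ ∑ k, rPenalty μ ‖T.adjoint (w k)‖ := by
  calc ∑ i, rPenalty μ (s i) = ∑ i, ∑ k, ‖⟪u i, w k⟫_𝕜‖ ^ 2 * rPenalty μ (s i) := by
        refine Finset.sum_congr rfl fun i _ => ?_
        rw [← Finset.sum_mul, w.sum_sq_norm_inner_left]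
        by_cases h0 : s i = 0
        · simp [h0, rPenalty_zero hμ]
        · simp [h.norm_eq_one i h0]
    _ = ∑ k, ∑ i, ‖⟪u i, w k⟫_𝕜‖ ^ 2 * rPenalty μ (s i) := Finset.sum_comm
    _ ≤ _ := by
        refine Finset.sum_le_sum fun k _ => ?_
        refine sum_mul_rPenalty_le hμ _ _ (fun i => by positivity) ?_ (norm_nonneg _)
          (h.norm_sq_adjoint_apply _)
        refine (sum_sq_norm_inner_le_of_orthogonal h.orthogonal h.norm_eq _).trans ?_
        simp

end IsSVD

variable [FiniteDimensional 𝕜 E] [FiniteDimensional 𝕜 F]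

lemma exists_isSVD_singularValues (T : E →ₗ[𝕜] F) {n : ℕ} (hn : Module.finrank 𝕜 E = n) :
    ∃ (v : OrthonormalBasis (Fin n) 𝕜 E) (u : Fin n → F),
      IsSVD T v (fun i => T.singularValues i) u := by
  set v := T.isSymmetric_adjoint_comp_self.eigenvectorBasis hn with hv
  have hin : ∀ i j, ⟪T (v i), T (v j)⟫_𝕜
      = (T.isSymmetric_adjoint_comp_self.eigenvalues hn j : 𝕜) * ⟪v i, v j⟫_𝕜 := by
    intro i j
    rw [← LinearMap.adjoint_inner_right, ← LinearMap.comp_apply, hv,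
      T.isSymmetric_adjoint_comp_self.apply_eigenvectorBasis hn j, inner_smul_right]
  have hs : ∀ i, ‖T (v i)‖ = T.singularValues i := by
    intro i
    have h := hin i i
    simp only [inner_self_eq_norm_sq_to_K, v.norm_eq_one] at h
    rw [← T.sq_singularValues_fin hn i] at h
    have h2 : ‖T (v i)‖ ^ 2 = T.singularValues i ^ 2 := by
      apply RCLike.ofReal_injective (K := 𝕜)
      push_cast
      simpa using h
    exact (pow_left_inj₀ (norm_nonneg _) (T.singularValues_nonneg i) two_ne_zero).1 h2
  have := IsSVD.of_orthogonal (T := T) (v := v) (fun i j hij => by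
    rw [hin, v.orthonormal.2 hij, mul_zero])
  simp only [hs] at this
  exact ⟨v, _, this⟩

/-- The spectral penalty `∑ᵢ r_μ(σᵢ(T))`. -/
def penalty (μ : ℝ) (T : E →ₗ[𝕜] F) : ℝ :=
  ∑ i ∈ Finset.range (Module.finrank 𝕜 E), rPenalty μ (T.singularValues i)

variable {μ : ℝ}

lemma penalty_eq_sum_fin (T : E →ₗ[𝕜] F) {n : ℕ} (hn : Module.finrank 𝕜 E = n) :
    penalty μ T = ∑ i : Fin n, rPenalty μ (T.singularValues i) := by
  rw [penalty, hn, Finset.sum_range]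

lemma penalty_le_sum (hμ : 0 ≤ μ) (T : E →ₗ[𝕜] F) (w : OrthonormalBasis κ 𝕜 E) :
    penalty μ T ≤ ∑ k, rPenalty μ ‖T (w k)‖ := by
  obtain ⟨v, u, h⟩ := exists_isSVD_singularValues T rfl
  rw [penalty_eq_sum_fin T rfl]
  exact h.sum_rPenalty_le hμ w

lemma penalty_le_sum_adjoint (hμ : 0 ≤ μ) (T : E →ₗ[𝕜] F) (w : OrthonormalBasis κ 𝕜 F) :
    penalty μ T ≤ ∑ k, rPenalty μ ‖T.adjoint (w k)‖ := by
  obtain ⟨v, u, h⟩ := exists_isSVD_singularValues T rfl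
  rw [penalty_eq_sum_fin T rfl]
  exact h.sum_rPenalty_le_adjoint hμ w

/-- Two decompositions bound each other by the variational inequality, so uniqueness of singular
values is not needed. -/
lemma IsSVD.penalty_eq (hμ : 0 ≤ μ) {T : E →ₗ[𝕜] F} {v : OrthonormalBasis ι 𝕜 E} {s : ι → ℝ}
    {u : ι → F} (h : IsSVD T v s u) : penalty μ T = ∑ i, rPenalty μ (s i) := by
  obtain ⟨v', u', h'⟩ := exists_isSVD_singularValues T rfl
  apply le_antisymm
  · simpa only [h.norm_apply_basis] using penalty_le_sum hμ T v
  · rw [penalty_eq_sum_fin T rfl]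
    simpa only [h'.norm_apply_basis] using h.sum_rPenalty_le hμ v'

lemma penalty_adjoint_le (hμ : 0 ≤ μ) (T : E →ₗ[𝕜] F) :
    penalty μ T.adjoint ≤ penalty μ T := by
  obtain ⟨v, u, h⟩ := exists_isSVD_singularValues T rfl
  have := penalty_le_sum_adjoint hμ T.adjoint v
  rw [LinearMap.adjoint_adjoint] at this
  rw [h.penalty_eq hμ]
  simpa only [h.norm_apply_basis] using this

/-- Both sides are the trace of `T* T`. -/
lemma sum_norm_sq_apply_eq (T : E →ₗ[𝕜] F) (v : OrthonormalBasis ι 𝕜 E)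
    (w : OrthonormalBasis κ 𝕜 E) : ∑ i, ‖T (v i)‖ ^ 2 = ∑ k, ‖T (w k)‖ ^ 2 := by
  have h := (LinearMap.trace_eq_sum_inner (T.adjoint ∘ₗ T) v).symm.trans
    (LinearMap.trace_eq_sum_inner (T.adjoint ∘ₗ T) w)
  simp only [LinearMap.comp_apply, LinearMap.adjoint_inner_right, inner_self_eq_norm_sq_to_K] at h
  exact_mod_cast h

end SVD

/-! ### Comparing two operators through overlaps of singular vectors. -/

section Comparison

open scoped InnerProductSpace

variable {𝕜 : Type*} [RCLike 𝕜]
  {E : Type*} [NormedAddCommGroup E] [InnerProductSpace 𝕜 E]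
  {F : Type*} [NormedAddCommGroup F] [InnerProductSpace 𝕜 F]
  {ι κ : Type*} [Fintype ι] [Fintype κ]
  {Y X : E →ₗ[𝕜] F} {v : OrthonormalBasis ι 𝕜 E} {y : ι → ℝ} {u : ι → F}
  {b : OrthonormalBasis κ 𝕜 E} {x : κ → ℝ} {a : κ → F}

/-- Overlap of the pairs of singular vectors `(v_i, u_i)` and `(b_j, a_j)`. -/
def overlap (𝕜 : Type*) [RCLike 𝕜] {E F : Type*} [NormedAddCommGroup E] [InnerProductSpace 𝕜 E]
    [NormedAddCommGroup F] [InnerProductSpace 𝕜 F] {ι κ : Type*} (v : ι → E) (u : ι → F)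
    (b : κ → E) (a : κ → F) (i : ι) (j : κ) : ℝ :=
  (‖⟪b j, v i⟫_𝕜‖ ^ 2 + ‖⟪u i, a j⟫_𝕜‖ ^ 2) / 2

lemma overlap_nonneg {ι κ : Type*} (v : ι → E) (u : ι → F) (b : κ → E) (a : κ → F) (i : ι) (j : κ) :
    0 ≤ overlap 𝕜 v u b a i j := by
  rw [overlap]
  positivity

lemma sum_overlap_right_le (hY : IsSVD Y v y u) (hX : IsSVD X b x a) (i : ι) :
    ∑ j, overlap 𝕜 v u b a i j ≤ 1 := by
  simp only [overlap]
  rw [← Finset.sum_div, Finset.sum_add_distrib, b.sum_sq_norm_inner_right]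
  have h := sum_sq_norm_inner_le_of_orthogonal hX.orthogonal hX.norm_eq (u i)
  simp only [norm_inner_symm _ (u i)] at h
  have := pow_le_one₀ (norm_nonneg _) (hY.norm_le_one i) (n := 2)
  rw [v.norm_eq_one]
  linarith

lemma sum_overlap_left_le (hY : IsSVD Y v y u) (hX : IsSVD X b x a) (j : κ) :
    ∑ i, overlap 𝕜 v u b a i j ≤ 1 := by
  simp only [overlap]
  rw [← Finset.sum_div, Finset.sum_add_distrib, v.sum_sq_norm_inner_left]
  have h := sum_sq_norm_inner_le_of_orthogonal hY.orthogonal hY.norm_eq (a j)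
  have := pow_le_one₀ (norm_nonneg _) (hX.norm_le_one j) (n := 2)
  rw [b.norm_eq_one]
  linarith

/-- Expand `X` in its decomposition and apply `2ab ≤ a² + b²` to each product of inner products. -/
lemma re_inner_le_sum_overlap {ι : Type*} (hX : IsSVD X b x a) (v : ι → E) (u : ι → F) (i : ι) :
    RCLike.re ⟪u i, X (v i)⟫_𝕜 ≤ ∑ j, overlap 𝕜 v u b a i j * x j := by
  rw [hX.apply_eq_sum, inner_sum, map_sum]
  refine Finset.sum_le_sum fun j _ => ?_
  rw [inner_smul_right]
  refine (RCLike.re_le_norm _).trans ?_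
  rw [norm_mul, norm_mul, RCLike.norm_ofReal, abs_of_nonneg (hX.nonneg j), overlap]
  have := mul_le_mul_of_nonneg_right
    (two_mul_le_add_sq ‖⟪b j, v i⟫_𝕜‖ ‖⟪u i, a j⟫_𝕜‖) (hX.nonneg j)
  linarith

variable [FiniteDimensional 𝕜 E] [FiniteDimensional 𝕜 F]

lemma sum_norm_sq_sub_apply (hY : IsSVD Y v y u) (hX : IsSVD X b x a) :
    ∑ i, ‖(X - Y) (v i)‖ ^ 2
      = ∑ i, y i ^ 2 + ∑ j, x j ^ 2 - 2 * ∑ i, y i * RCLike.re ⟪u i, X (v i)⟫_𝕜 := by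
  have h1 : ∑ j, x j ^ 2 = ∑ i, ‖X (v i)‖ ^ 2 := by
    rw [sum_norm_sq_apply_eq X v b]
    simp only [hX.norm_apply_basis]
  rw [h1, Finset.mul_sum, ← Finset.sum_add_distrib, ← Finset.sum_sub_distrib]
  refine Finset.sum_congr rfl fun i _ => ?_
  rw [LinearMap.sub_apply, norm_sub_sq (𝕜 := 𝕜), hY.norm_apply_basis, inner_re_symm, hY.apply_eq,
    inner_smul_left, RCLike.conj_ofReal, RCLike.re_ofReal_mul]
  ring

variable {μ c : ℝ}

theorem penalty_le_add_mul_sum_norm_sq (hμ : 0 ≤ μ) (hc : 0 ≤ c) (hc1 : c ≤ 1)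
    (hX : IsSVD X b x a) (hxc : ∀ j, x j = 0 ∨ √μ ≤ c * x j) (w : OrthonormalBasis ι 𝕜 E) :
    penalty μ X ≤ penalty μ Y + c * ∑ i, ‖(X - Y) (w i)‖ ^ 2 := by
  obtain ⟨v, u, hY⟩ := exists_isSVD_singularValues Y rfl
  rw [hX.penalty_eq hμ, hY.penalty_eq hμ, sum_norm_sq_apply_eq _ w v,
    sum_norm_sq_sub_apply hY hX]
  exact sum_rPenalty_le_of_substochastic hμ hc hc1 (overlap_nonneg _ _ _ _)
    (sum_overlap_right_le hY hX) (sum_overlap_left_le hY hX) hY.nonneg hX.nonneg hxc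
    (re_inner_le_sum_overlap hX _ _)

theorem sum_max_mul_re_inner_le (hc : 0 ≤ c) (hc1 : c ≤ 1) (hY : IsSVD Y v y u)
    (hX : IsSVD X b x a) (hxc : ∀ j, x j = 0 ∨ √μ ≤ c * x j) :
    ∑ i, max (√μ - y i) 0 * RCLike.re ⟪u i, (X - Y) (v i)⟫_𝕜
      ≤ c * ∑ i, ‖(X - Y) (v i)‖ ^ 2 := by
  have h : ∀ i, RCLike.re ⟪u i, (X - Y) (v i)⟫_𝕜 = RCLike.re ⟪u i, X (v i)⟫_𝕜 - y i := by
    intro i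
    rw [LinearMap.sub_apply, inner_sub_right, map_sub, hY.apply_eq, inner_smul_right,
      RCLike.re_ofReal_mul, inner_self_eq_norm_sq]
    by_cases h0 : y i = 0
    · simp [h0]
    · simp [hY.norm_eq_one i h0]
  simp only [h]
  rw [sum_norm_sq_sub_apply hY hX]
  exact sum_max_mul_sub_le_of_substochastic hc hc1 (overlap_nonneg _ _ _ _)
    (sum_overlap_right_le hY hX) (sum_overlap_left_le hY hX) hY.nonneg hX.nonneg hxc
    (re_inner_le_sum_overlap hX _ _)

end Comparison

/-! ### One-sided first-order bounds for the penalty. -/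

section Directional

open scoped InnerProductSpace

variable {𝕜 : Type*} [RCLike 𝕜]
  {E : Type*} [NormedAddCommGroup E] [InnerProductSpace 𝕜 E] [FiniteDimensional 𝕜 E]
  {F : Type*} [NormedAddCommGroup F] [InnerProductSpace 𝕜 F] [FiniteDimensional 𝕜 F]

/-- An orthonormal basis obtained by joining bases of a subspace and of its complement. -/
lemma exists_orthonormalBasis_sum (N : Submodule 𝕜 E) {ι κ : Type*} [Fintype ι] [Fintype κ]
    (v : OrthonormalBasis ι 𝕜 N) (w : OrthonormalBasis κ 𝕜 Nᗮ) :
    ∃ b : OrthonormalBasis (ι ⊕ κ) 𝕜 E, (∀ i, b (Sum.inl i) = v i) ∧ ∀ k, b (Sum.inr k) = w k :=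
  ⟨(v.prod w).map N.orthogonalDecomposition.symm, fun i => by simp, fun k => by simp⟩

/-- A singular value decomposition of `X` whose singular vectors for the singular value zero are
singular vectors of the compression of `D` to a map `ker X → (range X)ᗮ`. -/
lemma exists_adapted_isSVD (X D : E →ₗ[𝕜] F) :
    ∃ (k l : ℕ) (v : OrthonormalBasis (Fin k ⊕ Fin l) 𝕜 E) (x : Fin k ⊕ Fin l → ℝ)
      (u : Fin k ⊕ Fin l → F), IsSVD X v x u ∧ (∀ i, x i ≠ 0 → v i ∈ X.kerᗮ) ∧
      ∀ i, x i = 0 → v i ∈ X.ker ∧ u i ∈ X.rangeᗮ ∧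
        ∃ d : ℝ, 0 ≤ d ∧ X.rangeᗮ.starProjection (D (v i)) = (d : 𝕜) • u i := by
  set N := X.ker
  set T₁ : N →ₗ[𝕜] F := (X.rangeᗮ.starProjection : F →ₗ[𝕜] F) ∘ₗ D ∘ₗ N.subtype with hT₁
  set T₂ : Nᗮ →ₗ[𝕜] F := X ∘ₗ Nᗮ.subtype with hT₂
  obtain ⟨v₁, u₁, h₁⟩ := exists_isSVD_singularValues T₁ rfl
  obtain ⟨v₂, u₂, h₂⟩ := exists_isSVD_singularValues T₂ rfl
  obtain ⟨b, hb₁, hb₂⟩ := exists_orthonormalBasis_sum N v₁ v₂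
  set d : Fin (Module.finrank 𝕜 N) → ℝ := fun i => T₁.singularValues i with hd
  set s : Fin (Module.finrank 𝕜 Nᗮ) → ℝ := fun i => T₂.singularValues i with hs
  have hT₁v : ∀ i, X.rangeᗮ.starProjection (D (v₁ i)) = (d i : 𝕜) • u₁ i := h₁.apply_eq
  have hT₂v : ∀ i, X (v₂ i) = (s i : 𝕜) • u₂ i := h₂.apply_eq
  have hs0 : ∀ i, s i ≠ 0 := by
    intro i h0
    have h := hT₂v i
    rw [h0] at h
    have hmem : ((v₂ i : Nᗮ) : E) ∈ N := by simpa [N] using h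
    have hz : ((v₂ i : Nᗮ) : E) = 0 := by
      have := Submodule.inner_right_of_mem_orthogonal hmem (v₂ i).2
      simpa using this
    have := v₂.norm_eq_one i
    simp [Submodule.coe_eq_zero.1 hz] at this
  have hu₂ : ∀ i, u₂ i ∈ X.range := by
    intro i
    refine ⟨((s i : 𝕜)⁻¹) • (v₂ i : E), ?_⟩
    rw [map_smul, hT₂v, smul_smul, inv_mul_cancel₀ (by exact_mod_cast hs0 i), one_smul]
  -- Where `d i = 0`, the vector `u₁ i` need not be orthogonal to the range of `X`, so it is
  -- replaced by 0.
  set w : Fin (Module.finrank 𝕜 N) → F := fun i => if d i = 0 then 0 else u₁ i with hw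
  have hw' : ∀ i, (d i : 𝕜) • u₁ i = (d i : 𝕜) • w i := by
    intro i
    by_cases h : d i = 0 <;> simp [hw, h]
  have hwr : ∀ i, w i ∈ X.rangeᗮ := by
    intro i
    by_cases h : d i = 0
    · simp [hw, h]
    · have h2 : ((d i : 𝕜)⁻¹) • X.rangeᗮ.starProjection (D (v₁ i)) ∈ X.rangeᗮ :=
        Submodule.smul_mem _ _ (Submodule.starProjection_apply_mem _ _)
      rw [hT₁v, smul_smul, inv_mul_cancel₀ (by exact_mod_cast h), one_smul] at h2
      simpa [hw, h] using h2
  refine ⟨_, _, b, Sum.elim 0 s, Sum.elim w u₂, ⟨?_, ?_, ?_, ?_, ?_⟩, ?_, ?_⟩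
  · rintro (i | i)
    · simp
    · exact h₂.nonneg i
  · rintro (i | i)
    · have : X (v₁ i) = 0 := (v₁ i).2
      simp [hb₁, this]
    · simpa [hb₂] using hT₂v i
  · rintro (i | i) (j | j) hij
    · have hij' : i ≠ j := fun h => hij (by rw [h])
      simp only [Sum.elim_inl, hw]
      split_ifs <;> simp [h₁.orthogonal i j hij']
    · exact Submodule.inner_left_of_mem_orthogonal (hu₂ j) (hwr i)
    · exact Submodule.inner_right_of_mem_orthogonal (hu₂ i) (hwr j)
    · exact h₂.orthogonal i j fun h => hij (by rw [h])
  · rintro (i | i)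
    · by_cases h : d i = 0
      · simp [hw, h]
      · right
        simpa [hw, h] using h₁.norm_eq_one i h
    · exact h₂.norm_eq i
  · rintro (i | i) hi
    · simp at hi
    · exact h₂.norm_eq_one i hi
  · rintro (i | i) hi
    · simp at hi
    · rw [hb₂]
      exact (v₂ i).2
  · rintro (i | i) hi
    · rw [hb₁]
      exact ⟨(v₁ i).2, hwr i, d i, h₁.nonneg i, (hT₁v i).trans (hw' i)⟩
    · exact absurd hi (hs0 i)

variable {μ : ℝ}

/-- The variational bound in the basis `v` is exact at `t = 0`. Nonzero `x i` contribute through the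
tangent at `x i ^ 2`, zero ones through `r_μ(s) ≤ 2√μ s`. -/
lemma exists_penalty_add_smul_le {ι : Type*} [Fintype ι] (hμ : 0 ≤ μ) {X D : E →ₗ[𝕜] F}
    {v : OrthonormalBasis ι 𝕜 E} {x : ι → ℝ} {u : ι → F} (hX : IsSVD X v x u)
    (hD : ∀ i, x i = 0 → ∃ d : ℝ, 0 ≤ d ∧ D (v i) = (d : 𝕜) • u i) :
    ∃ C : ℝ, ∀ t : ℝ, 0 < t → penalty μ (X + (t : 𝕜) • D) ≤ penalty μ X
      + t * (2 * ∑ i, max (√μ - x i) 0 * RCLike.re ⟪u i, D (v i)⟫_𝕜) + C * t ^ 2 := by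
  refine ⟨∑ i, max (√μ - x i) 0 / x i * ‖D (v i)‖ ^ 2, fun t ht => ?_⟩
  refine (penalty_le_sum hμ _ v).trans ?_
  rw [hX.penalty_eq hμ, Finset.mul_sum, Finset.mul_sum, Finset.sum_mul, ← Finset.sum_add_distrib,
    ← Finset.sum_add_distrib]
  refine Finset.sum_le_sum fun i _ => ?_
  rw [LinearMap.add_apply, LinearMap.smul_apply]
  by_cases h0 : x i = 0
  · obtain ⟨d, hd0, hd⟩ := hD i h0
    have hXv : X (v i) = 0 := by simp [hX.apply_eq, h0]
    have hn : ‖(t : 𝕜) • D (v i)‖ = t * RCLike.re ⟪u i, D (v i)⟫_𝕜 := by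
      rw [hd, inner_smul_right, RCLike.re_ofReal_mul, inner_self_eq_norm_sq, norm_smul, norm_smul,
        RCLike.norm_ofReal, RCLike.norm_ofReal, abs_of_pos ht, abs_of_nonneg hd0]
      rcases hX.norm_eq i with h | h <;> simp [h]
    rw [hXv, zero_add, h0, rPenalty_zero hμ, sub_zero, max_eq_left (Real.sqrt_nonneg μ)]
    refine (rPenalty_le_linear hμ (norm_nonneg _)).trans (le_of_eq ?_)
    rw [hn]
    simp
    ring
  · have hx : 0 < x i := lt_of_le_of_ne (hX.nonneg i) (Ne.symm h0)
    refine (rPenalty_le_tangent hμ hx _).trans (le_of_eq ?_)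
    rw [norm_add_sq (𝕜 := 𝕜), hX.norm_apply_basis, hX.apply_eq, inner_smul_left, inner_smul_right,
      RCLike.conj_ofReal, RCLike.re_ofReal_mul, RCLike.re_ofReal_mul, norm_smul,
      RCLike.norm_ofReal, mul_pow, sq_abs]
    field_simp
    ring

/-- The range of `D*` lies in `ker X`, orthogonal to that of `X*`, so `‖(X + tD)* w‖² = ‖X* w‖² +
t²‖D* w‖²` has no linear term. -/
lemma exists_penalty_add_smul_le_of_adjoint (hμ : 0 ≤ μ) {X D : E →ₗ[𝕜] F}
    (hker : ∀ w, X (D.adjoint w) = 0) (hD : ∀ w, X.adjoint w = 0 → D.adjoint w = 0) :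
    ∃ C : ℝ, ∀ t : ℝ, penalty μ (X + (t : 𝕜) • D) ≤ penalty μ X + C * t ^ 2 := by
  obtain ⟨w, z, hw⟩ := exists_isSVD_singularValues X.adjoint rfl
  set s : Fin (Module.finrank 𝕜 F) → ℝ := fun i => X.adjoint.singularValues i with hs
  refine ⟨∑ i, max (√μ - s i) 0 / s i * ‖D.adjoint (w i)‖ ^ 2, fun t => ?_⟩
  refine (penalty_le_sum_adjoint hμ _ w).trans ?_
  refine le_trans ?_ (add_le_add_left (penalty_adjoint_le hμ X) _)
  rw [hw.penalty_eq hμ, Finset.sum_mul, ← Finset.sum_add_distrib]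
  refine Finset.sum_le_sum fun i _ => ?_
  have hadj : (X + (t : 𝕜) • D).adjoint (w i) = X.adjoint (w i) + (t : 𝕜) • D.adjoint (w i) := by
    simp [map_add, map_smulₛₗ]
  rw [hadj]
  by_cases h0 : s i = 0
  · have h1 : X.adjoint (w i) = 0 := by
      rw [← norm_eq_zero, hw.norm_apply_basis]
      exact h0
    simp [h1, hD _ h1, h0, rPenalty_zero hμ]
  · have hx : 0 < s i := lt_of_le_of_ne (hw.nonneg i) (Ne.symm h0)
    refine (rPenalty_le_tangent hμ hx _).trans (le_of_eq ?_)
    rw [norm_add_sq (𝕜 := 𝕜), hw.norm_apply_basis, LinearMap.adjoint_inner_left, map_smul, hker,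
      norm_smul, RCLike.norm_ofReal, mul_pow, sq_abs]
    simp
    ring

/-- Every direction `D` is a sum of two directions along which the penalty has first-order upper
bounds that add up to the sum of `2 max(√μ - xᵢ, 0) Re ⟨uᵢ, D vᵢ⟩` over a suitable singular value
decomposition of `X`. -/
lemma exists_direction_split (hμ : 0 ≤ μ) (X D : E →ₗ[𝕜] F) :
    ∃ (k l : ℕ) (v : OrthonormalBasis (Fin k ⊕ Fin l) 𝕜 E) (x : Fin k ⊕ Fin l → ℝ)
      (u : Fin k ⊕ Fin l → F) (D₁ D₂ : E →ₗ[𝕜] F) (C₁ C₂ : ℝ), IsSVD X v x u ∧ D₁ + D₂ = D ∧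
      (∀ t : ℝ, 0 < t → penalty μ (X + (t : 𝕜) • D₁) ≤ penalty μ X
        + t * (2 * ∑ i, max (√μ - x i) 0 * RCLike.re ⟪u i, D (v i)⟫_𝕜) + C₁ * t ^ 2) ∧
      ∀ t : ℝ, 0 < t → penalty μ (X + (t : 𝕜) • D₂) ≤ penalty μ X + C₂ * t ^ 2 := by
  obtain ⟨k, l, v, x, u, hX, hne, heq⟩ := exists_adapted_isSVD X D
  set P : F →ₗ[𝕜] F := X.range.starProjection.toLinearMap with hP
  set Q : E →ₗ[𝕜] E := X.ker.starProjection.toLinearMap with hQ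
  -- The block of `D` from `ker X` to the range of `X` is what keeps `D (v i)` from being a multiple
  -- of `u i` when `x i = 0`. It is invisible to the slope and is handled on the adjoint side.
  set D₂ : E →ₗ[𝕜] F := P ∘ₗ D ∘ₗ Q with hD₂
  have hinner : ∀ i, ⟪u i, (D - D₂) (v i)⟫_𝕜 = ⟪u i, D (v i)⟫_𝕜 := by
    intro i
    rw [LinearMap.sub_apply, inner_sub_right, sub_eq_self]
    by_cases h0 : x i = 0
    · exact Submodule.inner_left_of_mem_orthogonal (Submodule.starProjection_apply_mem _ _)
        (heq i h0).2.1
    · have : Q (v i) = 0 := (Submodule.starProjection_apply_eq_zero_iff _).2 (hne i h0)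
      simp [hD₂, this]
  obtain ⟨C₁, h₁⟩ := exists_penalty_add_smul_le (D := D - D₂) hμ hX (by
    intro i h0
    obtain ⟨hk, -, d, hd, h⟩ := heq i h0
    refine ⟨d, hd, ?_⟩
    rw [← h, Submodule.starProjection_orthogonal_val]
    have : Q (v i) = v i := Submodule.starProjection_eq_self_iff.2 hk
    simp [hD₂, this, hP])
  have hadj : ∀ w, D₂.adjoint w = Q (D.adjoint (P w)) := by
    intro w
    refine ext_inner_left 𝕜 fun z => ?_
    rw [LinearMap.adjoint_inner_right, hD₂, LinearMap.comp_apply, LinearMap.comp_apply,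
      (Submodule.starProjection_isSymmetric _) _ _, ← LinearMap.adjoint_inner_right,
      (Submodule.starProjection_isSymmetric _) _ _]
  obtain ⟨C₂, h₂⟩ := exists_penalty_add_smul_le_of_adjoint (D := D₂) hμ (X := X)
    (fun w => by
      rw [hadj]
      exact Submodule.starProjection_apply_mem X.ker _)
    (fun w hw => by
      have : P w = 0 := (Submodule.starProjection_apply_eq_zero_iff _).2
        (by rw [LinearMap.orthogonal_range]; exact hw)
      simp [hadj, this])
  simp only [hinner] at h₁
  exact ⟨k, l, v, x, u, D - D₂, D₂, C₁, C₂, hX, sub_add_cancel _ _, h₁, fun t _ => h₂ t⟩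

end Directional

/-! ### Stationary points in a normed space. -/

section Stationary

variable {E : Type*} [NormedAddCommGroup E]

lemma isStationaryPoint_of_le_add_sq {g : E → ℝ} {X : E} (h : ∀ Y, g X ≤ g Y + ‖Y - X‖ ^ 2) :
    IsStationaryPoint g X := by
  rw [IsStationaryPoint, le_liminf_iff]
  intro y hy
  have hlim : Tendsto (fun Y => ((-‖Y - X‖ : ℝ) : EReal)) (𝓝[≠] X) (𝓝 ((0 : ℝ) : EReal)) := by
    refine EReal.tendsto_coe.2 (tendsto_nhdsWithin_of_tendsto_nhds ?_)
    have : Continuous fun Y : E => -‖Y - X‖ := by fun_prop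
    simpa using this.tendsto X
  filter_upwards [hlim.eventually (lt_mem_nhds hy), self_mem_nhdsWithin] with Y h1 h2
  refine h1.trans_le (EReal.coe_le_coe_iff.2 ?_)
  have hpos : 0 < ‖Y - X‖ := norm_pos_iff.2 (sub_ne_zero.2 h2)
  rw [le_div_iff₀ hpos]
  linarith [h Y, pow_two ‖Y - X‖]

lemma IsStationaryPoint.nonneg_of_le [NormedSpace ℝ E] {g : E → ℝ} {X : E}
    (hX : IsStationaryPoint g X) {D : E} {β C : ℝ}
    (h : ∀ t : ℝ, 0 < t → g (X + t • D) ≤ g X + t * β + C * t ^ 2) : 0 ≤ β := by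
  have hlim : Tendsto (fun t : ℝ => β + C * t) (𝓝[>] 0) (𝓝 β) := by
    have : Continuous fun t : ℝ => β + C * t := by fun_prop
    simpa using tendsto_nhdsWithin_of_tendsto_nhds (s := Set.Ioi 0) (this.tendsto 0)
  rcases eq_or_ne D 0 with rfl | hD
  · refine ge_of_tendsto hlim ?_
    filter_upwards [self_mem_nhdsWithin] with t ht
    have ht : 0 < t := ht
    have := h t ht
    simp only [smul_zero, add_zero] at this
    nlinarith
  · by_contra! hβ
    have hDn : 0 < ‖D‖ := norm_pos_iff.2 hD
    -- Half the supposed negative slope, normalized by `‖D‖`, leaves room to absorb the quadratic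
    -- term.
    have hε : ((β / 2 / ‖D‖ : ℝ) : EReal) < 0 := by
      rw [← EReal.coe_zero, EReal.coe_lt_coe_iff]
      exact div_neg_of_neg_of_pos (by linarith) hDn
    have hev := eventually_lt_of_lt_liminf (hε.trans_le hX)
    have hcurve : Tendsto (fun t : ℝ => X + t • D) (𝓝[>] 0) (𝓝[≠] X) := by
      refine tendsto_nhdsWithin_iff.2 ⟨tendsto_nhdsWithin_of_tendsto_nhds ?_, ?_⟩
      · have : Continuous fun t : ℝ => X + t • D := by fun_prop
        simpa using this.tendsto 0
      · filter_upwards [self_mem_nhdsWithin] with t ht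
        simpa using ⟨(ne_of_gt ht : t ≠ 0), hD⟩
    obtain ⟨t, h1, h2, ht⟩ := ((hcurve.eventually hev).and
      ((hlim.eventually (gt_mem_nhds (by linarith : β < β / 2))).and
        self_mem_nhdsWithin)).exists
    have ht : 0 < t := ht
    rw [EReal.coe_lt_coe_iff, add_sub_cancel_left, norm_smul, Real.norm_eq_abs, abs_of_pos ht,
      div_lt_div_iff₀ hDn (by positivity)] at h1
    have h3 := h t ht
    have h4 : β / 2 * t < g (X + t • D) - g X := by nlinarith
    nlinarith

end Stationary

-- Translation between matrices and linear maps.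

attribute [local instance] Matrix.frobeniusNormedAddCommGroup Matrix.frobeniusNormedSpace

section MatrixLemmas

variable {𝕜 : Type*} [RCLike 𝕜] {n₁ n₂ : ℕ}

lemma toEuclideanLin_real_smul (t : ℝ) (X : Matrix (Fin n₁) (Fin n₂) 𝕜) :
    Matrix.toEuclideanLin (t • X) = (t : 𝕜) • Matrix.toEuclideanLin X := by
  rw [← map_smul]
  congr 1
  ext i j
  simp [RCLike.real_smul_eq_coe_mul]

lemma frobenius_norm_sq_eq_sum {ι : Type*} [Fintype ι] (X : Matrix (Fin n₁) (Fin n₂) 𝕜)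
    (v : OrthonormalBasis ι 𝕜 (EuclideanSpace 𝕜 (Fin n₂))) :
    ‖X‖ ^ 2 = ∑ i, ‖Matrix.toEuclideanLin X (v i)‖ ^ 2 := by
  rw [sum_norm_sq_apply_eq _ v (EuclideanSpace.basisFun (Fin n₂) 𝕜), Matrix.frobenius_norm_def,
    ← Real.sqrt_eq_rpow, Real.sq_sqrt (by positivity), Finset.sum_comm]
  refine Finset.sum_congr rfl fun j _ => ?_
  rw [EuclideanSpace.norm_sq_eq]
  refine Finset.sum_congr rfl fun i _ => ?_
  simp [Matrix.toLpLin_apply]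

lemma rank_eq_finrank_range_toEuclideanLin (X : Matrix (Fin n₁) (Fin n₂) 𝕜) :
    X.rank = Module.finrank 𝕜 (Matrix.toEuclideanLin X).range := by
  rw [Matrix.toEuclideanLin, Matrix.toLpLin_eq_toLin]
  exact Matrix.rank_eq_finrank_range_toLin X _ _

lemma rank_sub_le (X Y : Matrix (Fin n₁) (Fin n₂) 𝕜) : (X - Y).rank ≤ X.rank + Y.rank := by
  simp only [rank_eq_finrank_range_toEuclideanLin]
  refine (Submodule.finrank_mono ?_).trans (Submodule.finrank_add_le_finrank_add_finrank _ _)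
  rintro _ ⟨z, rfl⟩
  rw [map_sub, LinearMap.sub_apply]
  exact Submodule.sub_mem _ (Submodule.mem_sup_left (LinearMap.mem_range_self _ z))
    (Submodule.mem_sup_right (LinearMap.mem_range_self _ z))

lemma sum_rPenalty_singularValue {μ : ℝ} (hμ : 0 ≤ μ) (X : Matrix (Fin n₁) (Fin n₂) 𝕜) :
    ∑ i ∈ Finset.range (min n₁ n₂), rPenalty μ (singularValue X i)
      = penalty μ (Matrix.toEuclideanLin X) := by
  rw [penalty, finrank_euclideanSpace_fin]
  refine Finset.sum_subset (Finset.range_mono (min_le_right _ _)) fun i hi hi' => ?_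
  rw [Finset.mem_range] at hi hi'
  have h : Module.finrank 𝕜 (Matrix.toEuclideanLin X).range ≤ n₁ := by
    simpa using Submodule.finrank_le (Matrix.toEuclideanLin X).range
  rw [singularValue, (LinearMap.singularValues_eq_zero_iff_le_finrank_range _).2 (by omega), rPenalty_zero hμ]

lemma singularValue_eq_zero_or_ge {X : Matrix (Fin n₁) (Fin n₂) 𝕜} {K : ℕ} (hX : X.rank ≤ K)
    (i : ℕ) : singularValue X i = 0 ∨ singularValue X (K - 1) ≤ singularValue X i := by
  rcases le_or_gt K i with h | h
  · left
    rw [rank_eq_finrank_range_toEuclideanLin] at hX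
    exact (LinearMap.singularValues_eq_zero_iff_le_finrank_range _).2 (hX.trans h)
  · right
    exact LinearMap.singularValues_antitone _ (by omega)

end MatrixLemmas

/-! ### The functional: comparison with `X₀` and stationary points. -/

section Main

variable {𝕜 𝕂 : Type*} [RCLike 𝕜] [RCLike 𝕂] {n₁ n₂ m : ℕ}
  {A : Matrix (Fin n₁) (Fin n₂) 𝕜 →ₗ[ℝ] EuclideanSpace 𝕂 (Fin m)} {μ c : ℝ}
  {X₀ : Matrix (Fin n₁) (Fin n₂) 𝕜}

lemma lripConst_mul_norm_sq_le (A : Matrix (Fin n₁) (Fin n₂) 𝕜 →ₗ[ℝ] EuclideanSpace 𝕂 (Fin m))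
    {k : ℕ} {X : Matrix (Fin n₁) (Fin n₂) 𝕜} (hX : X.rank ≤ k) :
    (1 - lripConst A k) * ‖X‖ ^ 2 ≤ ‖A X‖ ^ 2 := by
  rcases eq_or_ne X 0 with rfl | h0
  · simp
  · rw [lripConst, sub_sub_cancel, ← le_div_iff₀ (by positivity)]
    refine csInf_le ⟨0, ?_⟩ ⟨X, h0, hX, rfl⟩
    rintro _ ⟨Y, -, -, rfl⟩
    positivity

lemma regFunctional_eq (hμ : 0 ≤ μ) (A : Matrix (Fin n₁) (Fin n₂) 𝕜 →ₗ[ℝ] EuclideanSpace 𝕂 (Fin m))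
    (b : EuclideanSpace 𝕂 (Fin m)) (X : Matrix (Fin n₁) (Fin n₂) 𝕜) :
    regFunctional A b μ X = penalty μ (Matrix.toEuclideanLin X) + ‖A X - b‖ ^ 2 := by
  rw [regFunctional, sum_rPenalty_singularValue hμ]

lemma penalty_le_add_mul_norm_sq (hμ : 0 ≤ μ) (hc : 0 ≤ c) (hc1 : c ≤ 1)
    (hσ : ∀ i, singularValue X₀ i = 0 ∨ √μ ≤ c * singularValue X₀ i)
    (Y : Matrix (Fin n₁) (Fin n₂) 𝕜) :
    penalty μ (Matrix.toEuclideanLin X₀)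
      ≤ penalty μ (Matrix.toEuclideanLin Y) + c * ‖Y - X₀‖ ^ 2 := by
  obtain ⟨b, a, h⟩ := exists_isSVD_singularValues (Matrix.toEuclideanLin X₀)
    (finrank_euclideanSpace_fin (𝕜 := 𝕜) (n := n₂))
  rw [norm_sub_rev, frobenius_norm_sq_eq_sum _ b, map_sub]
  exact penalty_le_add_mul_sum_norm_sq hμ hc hc1 h (fun j => hσ j) b

lemma isStationaryReg_self (hμ : 0 ≤ μ)
    (hσ : ∀ i, singularValue X₀ i = 0 ∨ √μ ≤ singularValue X₀ i) :
    IsStationaryReg A (A X₀) μ X₀ := by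
  refine isStationaryPoint_of_le_add_sq fun Y => ?_
  have h := penalty_le_add_mul_norm_sq hμ zero_le_one le_rfl (by simpa using hσ) Y
  have := sq_nonneg ‖A Y - A X₀‖
  rw [regFunctional_eq hμ, regFunctional_eq hμ, sub_self, norm_zero]
  linarith

lemma regFunctional_lt (hμ : 0 ≤ μ) (hc : 0 ≤ c) (hc1 : c ≤ 1)
    (hσ : ∀ i, singularValue X₀ i = 0 ∨ √μ ≤ c * singularValue X₀ i)
    {Y : Matrix (Fin n₁) (Fin n₂) 𝕜} (hY : c * ‖Y - X₀‖ ^ 2 < ‖A (Y - X₀)‖ ^ 2) :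
    regFunctional A (A X₀) μ X₀ < regFunctional A (A X₀) μ Y := by
  have h := penalty_le_add_mul_norm_sq hμ hc hc1 hσ Y
  rw [regFunctional_eq hμ, regFunctional_eq hμ, sub_self, norm_zero, ← map_sub]
  linarith

/-- Stationarity is tested along `D₁` and `D₂` separately. The data term has a linear derivative, so
the two inequalities add up to one for the direction `X₀ - X`. -/
lemma norm_sq_map_sub_le_of_isStationaryReg (hμ : 0 ≤ μ) (hc : 0 ≤ c) (hc1 : c ≤ 1)
    (hσ : ∀ i, singularValue X₀ i = 0 ∨ √μ ≤ c * singularValue X₀ i)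
    {X : Matrix (Fin n₁) (Fin n₂) 𝕜} (hX : IsStationaryReg A (A X₀) μ X) :
    ‖A (X - X₀)‖ ^ 2 ≤ c * ‖X - X₀‖ ^ 2 := by
  obtain ⟨k, l, v, x, u, D₁, D₂, C₁, C₂, hsvd, hD, h₁, h₂⟩ :=
    exists_direction_split hμ (Matrix.toEuclideanLin X) (Matrix.toEuclideanLin (X₀ - X))
  obtain ⟨D₁, rfl⟩ := Matrix.toEuclideanLin.surjective D₁
  obtain ⟨D₂, rfl⟩ := Matrix.toEuclideanLin.surjective D₂
  rw [← map_add] at hD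
  replace hD := Matrix.toEuclideanLin.injective hD
  set β := 2 * ∑ i, max (√μ - x i) 0 *
    RCLike.re (inner 𝕜 (u i) (Matrix.toEuclideanLin (X₀ - X) (v i))) with hβ
  have hexp : ∀ (D : Matrix (Fin n₁) (Fin n₂) 𝕜) (t : ℝ), ‖A (X + t • D) - A X₀‖ ^ 2
      = ‖A X - A X₀‖ ^ 2 + t * (2 * RCLike.re (inner 𝕂 (A (X - X₀)) (A D)))
        + ‖A D‖ ^ 2 * t ^ 2 := by
    intro D t
    rw [map_add, map_smul, add_sub_right_comm, norm_add_sq (𝕜 := 𝕂), norm_smul,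
      RCLike.real_smul_eq_coe_smul (K := 𝕂), inner_smul_right, RCLike.re_ofReal_mul, map_sub,
      mul_pow, Real.norm_eq_abs, sq_abs]
    ring
  have e₁ := hX.nonneg_of_le (D := D₁)
    (β := β + 2 * RCLike.re (inner 𝕂 (A (X - X₀)) (A D₁))) (C := C₁ + ‖A D₁‖ ^ 2) (by
      intro t ht
      have := h₁ t ht
      rw [regFunctional_eq hμ, regFunctional_eq hμ, hexp, map_add, toEuclideanLin_real_smul]
      linarith)
  have e₂ := hX.nonneg_of_le (D := D₂)
    (β := 2 * RCLike.re (inner 𝕂 (A (X - X₀)) (A D₂))) (C := C₂ + ‖A D₂‖ ^ 2) (by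
      intro t ht
      have := h₂ t ht
      rw [regFunctional_eq hμ, regFunctional_eq hμ, hexp, map_add, toEuclideanLin_real_smul]
      linarith)
  have hsum : RCLike.re (inner 𝕂 (A (X - X₀)) (A D₁)) + RCLike.re (inner 𝕂 (A (X - X₀)) (A D₂))
      = -‖A (X - X₀)‖ ^ 2 := by
    rw [← map_add, ← inner_add_right, ← map_add, hD, ← neg_sub X X₀, map_neg, inner_neg_right,
      map_neg, inner_self_eq_norm_sq]
  obtain ⟨b, a, h⟩ := exists_isSVD_singularValues (Matrix.toEuclideanLin X₀)
    (finrank_euclideanSpace_fin (𝕜 := 𝕜) (n := n₂))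
  have hfin := sum_max_mul_re_inner_le (μ := μ) hc hc1 hsvd h (fun j => hσ j)
  rw [← map_sub, ← frobenius_norm_sq_eq_sum, norm_sub_rev] at hfin
  linarith

end Main

end LowRank

end

theorem theorem1p2 {𝕜 𝕂 : Type*} [RCLike 𝕜] [RCLike 𝕂] {n₁ n₂ m : ℕ}
    (A : Matrix (Fin n₁) (Fin n₂) 𝕜 →ₗ[ℝ] EuclideanSpace 𝕂 (Fin m))
    (b : EuclideanSpace 𝕂 (Fin m)) (X₀ : Matrix (Fin n₁) (Fin n₂) 𝕜)
    (K : ℕ) (μ : ℝ) (hK : 1 ≤ K) (hμ : 0 ≤ μ)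
    (hb : b = A X₀) (hrank : X₀.rank = K)
    (hδ_pos : 0 < LowRank.lripConst A (2 * K)) (hδ_lt : LowRank.lripConst A (2 * K) < 1)
    (hσ : √μ / (1 - LowRank.lripConst A (2 * K)) < LowRank.singularValue X₀ (K - 1)) :
    LowRank.IsStationaryReg A b μ X₀ ∧
    {X : Matrix (Fin n₁) (Fin n₂) 𝕜 | X.rank ≤ K ∧
        ∀ Y : Matrix (Fin n₁) (Fin n₂) 𝕜, Y.rank ≤ K →
          LowRank.regFunctional A b μ X ≤ LowRank.regFunctional A b μ Y} = {X₀} ∧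
    ∀ X : Matrix (Fin n₁) (Fin n₂) 𝕜,
      LowRank.IsStationaryReg A b μ X → X ≠ X₀ → K < X.rank := by
  subst hb
  let _ : NormedAddCommGroup (Matrix (Fin n₁) (Fin n₂) 𝕜) := Matrix.frobeniusNormedAddCommGroup
  set δ := LowRank.lripConst A (2 * K) with hδ
  set σ := LowRank.singularValue X₀ (K - 1) with hσ'
  have hδ1 : 0 < 1 - δ := by linarith
  have hσ0 : 0 < σ := lt_of_le_of_lt (by positivity) hσ
  have hσδ : √μ / σ < 1 - δ := by
    rw [div_lt_iff₀ hδ1] at hσ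
    rw [div_lt_iff₀ hσ0]
    linarith
  -- The strict gap leaves room for a `c` that meets the singular value condition and still lies
  -- strictly below `1 - δ`.
  obtain ⟨c, hc_gt, hc_lt⟩ := exists_between hσδ
  have hc : 0 ≤ c := le_trans (by positivity) hc_gt.le
  have hc1 : c ≤ 1 := by linarith
  have hsv : ∀ i, LowRank.singularValue X₀ i = 0 ∨ √μ ≤ c * LowRank.singularValue X₀ i := by
    intro i
    refine (LowRank.singularValue_eq_zero_or_ge hrank.le i).imp_right fun h => ?_
    rw [div_lt_iff₀ hσ0] at hc_gt
    exact hc_gt.le.trans (mul_le_mul_of_nonneg_left h hc)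
  have hA : ∀ Y : Matrix (Fin n₁) (Fin n₂) 𝕜, Y.rank ≤ K → Y ≠ X₀ →
      c * ‖Y - X₀‖ ^ 2 < ‖A (Y - X₀)‖ ^ 2 := by
    intro Y hY hne
    have hpos : 0 < ‖Y - X₀‖ := norm_pos_iff.2 (sub_ne_zero.2 hne)
    have h1 : (1 - δ) * ‖Y - X₀‖ ^ 2 ≤ ‖A (Y - X₀)‖ ^ 2 :=
      LowRank.lripConst_mul_norm_sq_le A ((LowRank.rank_sub_le Y X₀).trans (by omega))
    have h2 : c * ‖Y - X₀‖ ^ 2 < (1 - δ) * ‖Y - X₀‖ ^ 2 :=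
      mul_lt_mul_of_pos_right hc_lt (by positivity)
    exact h2.trans_le h1
  refine ⟨?_, ?_, ?_⟩
  · refine LowRank.isStationaryReg_self hμ fun i => (hsv i).imp_right fun h => h.trans ?_
    exact mul_le_of_le_one_left (LinearMap.singularValues_nonneg _ i) hc1
  · have hmin : ∀ Y : Matrix (Fin n₁) (Fin n₂) 𝕜, Y.rank ≤ K → Y ≠ X₀ →
        LowRank.regFunctional A (A X₀) μ X₀ < LowRank.regFunctional A (A X₀) μ Y :=
      fun Y hY hne => LowRank.regFunctional_lt hμ hc hc1 hsv (hA Y hY hne)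
    ext X
    constructor
    · rintro ⟨hX, h⟩
      by_contra hne
      exact absurd (h X₀ hrank.le) (not_le.2 (hmin X hX hne))
    · rintro rfl
      refine ⟨hrank.le, fun Y hY => ?_⟩
      rcases eq_or_ne Y X with rfl | hne
      · exact le_rfl
      · exact (hmin Y hY hne).le
  · intro X hX hne
    by_contra! hle
    exact absurd (LowRank.norm_sq_map_sub_le_of_isStationaryReg hμ hc hc1 hsv hX)
      (not_le.2 (hA X hle hne))
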